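/- Let $n$ be a positive integer. For a compact set $\mathbf A\subset\mathbb R^{n\times n}$ consider the switched linear system $$S_{\mathbf A}:\qquad \dot x(t)=A(t)\,x(t),\qquad x\in\mathbb R^n,\qquad A(\cdot):[0,\infty)\to\mathbf A \text{ measurable},$$ and let $\phi^{A(\cdot)}_t(x_0)$ denote the value at time $t\ge 0$ of its (Carathéodory) solution with switching function $A(\cdot)$ and initial condition $x_0$. The system $S_{\mathbf A}$ is called (a) *globally uniformly exponentially stable* (GUES) if there are constants $M>0$ and $\lambda>0$ such that $\|\phi^{A(\cdot)}_t(x_0)\|\le M e^{-\lambda t}\|x_0\|$ for every $x_0\in\mathbb R^n$, every $t>0$ and every switching function $A(\cdot)$; (b) *uniformly stable* if for every $\varepsilon>0$ there is $\delta>0$ such that $\|\phi^{A(\cdot)}_t(x_0)\|\le\varepsilon$ for every switching function $A(\cdot)$, every $t\ge 0$ and every $x_0$ with $\|x_0\|\le\delta$. The *convex semicone* generated by a set $D$ of matrices is $\{\lambda x:\lambda>0,\ x\in\operatorname{co}(D)\}$, where $\operatorname{co}(D)$ is the convex hull of $D$. Let $\mathbf A$ and $\mathbf A'$ be compact subsets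 of $\mathbb R^{n\times n}$ that generate the same convex semicone. Then $S_{\mathbf A}$ is GUES if and only if $S_{\mathbf A'}$ is GUES, and $S_{\mathbf A}$ is uniformly stable if and only if $S_{\mathbf A'}$ is uniformly stable. -/

import Mathlib

open MeasureTheory Set

namespace SwitchedSystem

/-- The convex semicone generated by a set `D`: the points `c • x` with `0 < c` and
`x` in the convex hull of `D`. -/
def convexSemicone {E : Type*} [AddCommGroup E] [Module ℝ E] (D : Set E) : Set E :=
  {y | ∃ c : ℝ, 0 < c ∧ ∃ x ∈ convexHull ℝ D, y = c • x}

/-- The switching functions of the system associated with the set of matrices `𝒜`: measurable maps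
`[0, ∞) → 𝒜`. They are represented by measurable maps on `ℝ`, of which only the values on `[0, ∞)`
are constrained or used.
Measurability of a matrix-valued map is measurability of its entries. -/
structure IsSwitchingFunction {n : ℕ} (𝒜 : Set (Matrix (Fin n) (Fin n) ℝ))
    (A : ℝ → Matrix (Fin n) (Fin n) ℝ) : Prop where
  measurable : ∀ i j : Fin n, Measurable fun t => A t i j
  mem : ∀ t : ℝ, 0 ≤ t → A t ∈ 𝒜

/-- `x` is on `[0, ∞)` a Carathéodory solution of `ẋ(t) = A(t) x(t)` with `x(0) = x₀`:
`s ↦ A(s) x(s)` is Lebesgue integrable on every `[0, t]`, and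
`x(t) = x₀ + ∫₀ᵗ A(s) x(s) ds` for every `t ≥ 0`. (Equivalently, `x` is absolutely continuous on
compact intervals, satisfies the equation almost everywhere, and `x(0) = x₀`.) -/
structure IsCaratheodorySolution {n : ℕ} (A : ℝ → Matrix (Fin n) (Fin n) ℝ)
    (x₀ : EuclideanSpace ℝ (Fin n)) (x : ℝ → EuclideanSpace ℝ (Fin n)) : Prop where
  integrable : ∀ t : ℝ, 0 ≤ t →
    IntervalIntegrable (fun s => (A s).toEuclideanLin (x s)) volume 0 t
  integral_eq : ∀ t : ℝ, 0 ≤ t →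
    x t = x₀ + ∫ s in (0 : ℝ)..t, (A s).toEuclideanLin (x s)

/-- The origin is uniformly stable for `ẋ(t) = A(t) x(t)`, `A(·) : [0, ∞) → 𝒜` measurable: for
every `ε > 0` there is `δ > 0`, independent of the switching function, such that
solutions starting in the closed `δ`-ball remain in the closed `ε`-ball for all `t ≥ 0`. -/
def UniformlyStable {n : ℕ} (𝒜 : Set (Matrix (Fin n) (Fin n) ℝ)) : Prop :=
  ∀ ε : ℝ, 0 < ε → ∃ δ : ℝ, 0 < δ ∧
    ∀ A : ℝ → Matrix (Fin n) (Fin n) ℝ, IsSwitchingFunction 𝒜 A →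
      ∀ (x₀ : EuclideanSpace ℝ (Fin n)) (x : ℝ → EuclideanSpace ℝ (Fin n)),
        IsCaratheodorySolution A x₀ x → ‖x₀‖ ≤ δ → ∀ t : ℝ, 0 ≤ t → ‖x t‖ ≤ ε

/-- The origin is globally uniformly exponentially stable for `ẋ(t) = A(t) x(t)`,
`A(·) : [0, ∞) → 𝒜` measurable. -/
def GUES {n : ℕ} (𝒜 : Set (Matrix (Fin n) (Fin n) ℝ)) : Prop :=
  ∃ M r : ℝ, 0 < M ∧ 0 < r ∧
    ∀ A : ℝ → Matrix (Fin n) (Fin n) ℝ, IsSwitchingFunction 𝒜 A →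
      ∀ (x₀ : EuclideanSpace ℝ (Fin n)) (x : ℝ → EuclideanSpace ℝ (Fin n)),
        IsCaratheodorySolution A x₀ x →
          ∀ t : ℝ, 0 < t → ‖x t‖ ≤ M * Real.exp (-r * t) * ‖x₀‖

end SwitchedSystem

/-! Stability is turned into a condition on single matrices that passes to the semicone. A bound `C
* exp (-r * t)` on solutions bounds the monoid generated by the flows of `A + r`, `A ∈ 𝒜`, and the
supremum over this monoid is a seminorm `V` that each flow contracts (`exists_lyapunov`).
Differentiating at time 0 gives `f (A x) ≤ -r * V x` for every functional `f` supporting `V` at `x`.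
This is linear in `A`, so it survives convex combinations, and multiplying `A` by `c > 0` multiplies
the rate by `c`. Conversely, it integrates along any measurable switching function
(`IsCaratheodorySolution.seminorm_le`). Uniform stability is the case `r = 0`; for GUES, compactness
bounds `c` below on `𝒜'`, unless `0 ∈ 𝒜'`, which forces the space to be trivial. -/

open Filter Topology

namespace SwitchedSystem

/-! ### Contracted seminorms and the dissipation inequality. -/

section Seminorms

variable {E : Type*} [NormedAddCommGroup E] [NormedSpace ℝ E]

/-- A uniformly bounded monoid of operators is contractive for an equivalent seminorm. -/
lemma exists_seminorm_contractive (G : Submonoid (E →L[ℝ] E)) {C : ℝ}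
    (hG : ∀ g ∈ G, ∀ x, ‖g x‖ ≤ C * ‖x‖) :
    ∃ V : Seminorm ℝ E, (∀ x, ‖x‖ ≤ V x) ∧ (∀ x, V x ≤ C * ‖x‖) ∧
      ∀ g ∈ G, ∀ x, V (g x) ≤ V x := by
  have hbdd : ∀ x, BddAbove (Set.range fun g : G => ‖(g : E →L[ℝ] E) x‖) := fun x =>
    ⟨C * ‖x‖, by rintro _ ⟨g, rfl⟩; exact hG g g.2 x⟩
  let V : Seminorm ℝ E := Seminorm.of (fun x => ⨆ g : G, ‖(g : E →L[ℝ] E) x‖)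
    (fun x y => ciSup_le fun g => by
      rw [map_add]
      exact (norm_add_le _ _).trans
        (add_le_add (le_ciSup (hbdd x) g) (le_ciSup (hbdd y) g)))
    (fun a x => by
      simp only [map_smul, norm_smul]
      exact (Real.mul_iSup_of_nonneg (norm_nonneg a) _).symm)
  refine ⟨V, fun x => ?_, fun x => ciSup_le fun g => hG g g.2 x, fun g hg x =>
    ciSup_le fun k => ?_⟩
  -- The identity gives the lower bound; closure of `G` under products gives contractivity.
  · exact le_ciSup (hbdd x) (1 : G)
  · exact le_ciSup (hbdd x) (k * ⟨g, hg⟩)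

/-- Every point has a supporting linear functional of a given seminorm. -/
lemma exists_support_functional (V : Seminorm ℝ E) (x : E) :
    ∃ f : E →ₗ[ℝ] ℝ, (∀ y, f y ≤ V y) ∧ f x = V x := by
  rcases eq_or_ne x 0 with rfl | hx
  · exact ⟨0, fun y => apply_nonneg V y, by simp⟩
  · let p : E →ₗ.[ℝ] ℝ := LinearPMap.mkSpanSingleton x (V x) hx
    obtain ⟨f, hf, hfV⟩ := exists_extension_of_le_sublinear p V
      (fun c hc y => by rw [map_smul_eq_mul, Real.norm_of_nonneg hc.le])
      (fun y z => map_add_le_add V y z) (by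
        rintro ⟨y, hy⟩
        obtain ⟨c, rfl⟩ := Submodule.mem_span_singleton.1 hy
        have hp : p ⟨c • x, hy⟩ = c * V x := LinearPMap.mkSpanSingleton'_apply x (V x) _ c hy
        rw [hp, map_smul_eq_mul]
        exact mul_le_mul_of_nonneg_right (le_abs_self c) (apply_nonneg V x))
    refine ⟨f, hfV, ?_⟩
    have h := hf ⟨x, Submodule.mem_span_singleton_self x⟩
    rw [h]
    exact LinearPMap.mkSpanSingleton_apply ℝ ℝ hx (V x)

/-- `V` satisfies `dV(x; B x) ≤ -ρ V(x)`, expressed through supporting functionals of `V`. -/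
def Dissipates (V : Seminorm ℝ E) (ρ : ℝ) (B : E →L[ℝ] E) : Prop :=
  ∀ f : E →ₗ[ℝ] ℝ, (∀ y, f y ≤ V y) → ∀ x, f x = V x → f (B x) ≤ -ρ * V x

/-- For fixed `f` and `x` the condition on `B` is a half-space. -/
lemma convex_setOf_dissipates (V : Seminorm ℝ E) (ρ : ℝ) :
    Convex ℝ {B : E →L[ℝ] E | Dissipates V ρ B} := by
  intro B hB B' hB' a b ha hb hab f hf x hx
  simp only [add_apply, smul_apply, map_add, map_smul, smul_eq_mul]
  calc a * f (B x) + b * f (B' x) ≤ a * (-ρ * V x) + b * (-ρ * V x) :=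
        add_le_add (mul_le_mul_of_nonneg_left (hB f hf x hx) ha)
          (mul_le_mul_of_nonneg_left (hB' f hf x hx) hb)
    _ = -ρ * V x := by rw [← add_mul, hab, one_mul]

lemma Dissipates.smul {V : Seminorm ℝ E} {ρ : ℝ} {B : E →L[ℝ] E} (hB : Dissipates V ρ B)
    {c : ℝ} (hc : 0 ≤ c) : Dissipates V (c * ρ) (c • B) := by
  intro f hf x hx
  simp only [smul_apply, map_smul, smul_eq_mul]
  linarith [mul_le_mul_of_nonneg_left (hB f hf x hx) hc]

lemma Dissipates.mono {V : Seminorm ℝ E} {ρ σ : ℝ} {B : E →L[ℝ] E} (hB : Dissipates V ρ B)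
    (h : σ ≤ ρ) : Dissipates V σ B := by
  intro f hf x hx
  linarith [hB f hf x hx, mul_le_mul_of_nonneg_right h (apply_nonneg V x)]

lemma exp_zero_smul_apply (B : E →L[ℝ] E) (y : E) :
    NormedSpace.exp ((0 : ℝ) • B) y = y := by
  rw [zero_smul, NormedSpace.exp_zero, one_apply_eq_self]

lemma hasDerivAt_exp_smul_apply [CompleteSpace E] (B : E →L[ℝ] E) (y : E) (T t : ℝ) :
    HasDerivAt (fun s : ℝ => NormedSpace.exp ((s - T) • B) y)
      (B (NormedSpace.exp ((t - T) • B) y)) t := by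
  have h := (hasDerivAt_exp_smul_const' (𝕂 := ℝ) B (t - T)).comp_sub_const t T
  simpa using h.clm_apply (hasDerivAt_const t y)

/-- If the flow of `B + r` is contractive for `V`, then `B` dissipates `V` at rate `r`. -/
lemma dissipates_of_contractive [FiniteDimensional ℝ E] {V : Seminorm ℝ E} {r : ℝ}
    {B : E →L[ℝ] E}
    (h : ∀ t : ℝ, 0 ≤ t → ∀ x, V (NormedSpace.exp (t • (B + r • 1)) x) ≤ V x) :
    Dissipates V r B := by
  intro f hf x hx
  have : CompleteSpace E := FiniteDimensional.complete ℝ E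
  have hd : HasDerivAt (fun s : ℝ => f (NormedSpace.exp (s • (B + r • 1)) x))
      (f ((B + r • 1) x)) 0 := by
    have h1 := hasDerivAt_exp_smul_apply (B + r • (1 : E →L[ℝ] E)) x 0 0
    simp only [sub_zero, zero_smul, NormedSpace.exp_zero, one_apply_eq_self] at h1
    exact f.toContinuousLinearMap.hasFDerivAt.comp_hasDerivAt 0 h1
  -- With `g` the flow at time `t ≥ 0`, `f (g x) ≤ V (g x) ≤ V x = f x`, so right difference
  -- quotients are nonpositive.
  have hle : f ((B + r • 1) x) ≤ 0 := by
    refine le_of_tendsto (hasDerivWithinAt_iff_tendsto_slope' (s := Ioi (0 : ℝ))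
      (by simp) |>.1 hd.hasDerivWithinAt) ?_
    filter_upwards [self_mem_nhdsWithin] with t ht
    rw [slope_def_field]
    refine div_nonpos_of_nonpos_of_nonneg ?_ (by simpa using (le_of_lt ht))
    simp only [zero_smul, NormedSpace.exp_zero, one_apply_eq_self, hx]
    linarith [hf (NormedSpace.exp (t • (B + r • 1)) x), h t (le_of_lt ht) x]
  simp only [add_apply, smul_apply, one_apply_eq_self, map_add, map_smul, smul_eq_mul, hx] at hle
  linarith

/-- Along a curve, the derivative of a seminorm is computed by any supporting functional. -/
lemma deriv_seminorm_comp_eq [FiniteDimensional ℝ E] {V : Seminorm ℝ E} {x : ℝ → E} {x' : E}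
    {t : ℝ} (hx : HasDerivAt x x' t) (hV : DifferentiableAt ℝ (fun s => V (x s)) t)
    {f : E →ₗ[ℝ] ℝ} (hf : ∀ y, f y ≤ V y) (hft : f (x t) = V (x t)) :
    deriv (fun s => V (x s)) t = f x' := by
  have hd : HasDerivAt (fun s => f (x s)) (f x') t :=
    f.toContinuousLinearMap.hasFDerivAt.comp_hasDerivAt t hx
  have hmin : IsLocalMin (fun s => V (x s) - f (x s)) t :=
    Eventually.of_forall fun s => by simpa [hft] using hf (x s)
  have := hmin.hasDerivAt_eq_zero (hV.hasDerivAt.sub hd)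
  linarith

end Seminorms

/-- An absolutely continuous function with `v' ≤ -ρ v` almost everywhere decays exponentially. -/
lemma le_exp_mul_of_ae_deriv_le {v : ℝ → ℝ} {ρ T : ℝ} (hT : 0 ≤ T)
    (hv : AbsolutelyContinuousOnInterval v 0 T)
    (hd : ∀ᵐ t, t ∈ uIcc 0 T → deriv v t ≤ -ρ * v t) :
    v T ≤ Real.exp (-ρ * T) * v 0 := by
  -- Integrating factor: the derivative of `exp (ρ * t) * v t` is nonpositive almost everywhere.
  have hexp : ∀ t, HasDerivAt (fun t => Real.exp (ρ * t)) (ρ * Real.exp (ρ * t)) t := fun t => by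
    have := ((hasDerivAt_id t).const_mul ρ).exp
    simpa [mul_comm] using this
  have hac : AbsolutelyContinuousOnInterval (fun t => Real.exp (ρ * t)) 0 T :=
    ContDiffOn.absolutelyContinuousOnInterval (by fun_prop)
  have hint := hac.integral_deriv_mul_eq_sub hv
  have hle : ∫ t in (0 : ℝ)..T, (deriv (fun t => Real.exp (ρ * t)) t * v t
      + Real.exp (ρ * t) * deriv v t) ≤ 0 := by
    rw [intervalIntegral.integral_of_le hT]
    refine integral_nonpos_of_ae ?_
    filter_upwards [ae_restrict_of_ae hd, ae_restrict_mem measurableSet_Ioc] with t ht htm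
    rw [(hexp t).deriv]
    have h1 := ht (by rw [uIcc_of_le hT]; exact Ioc_subset_Icc_self htm)
    have h2 := mul_le_mul_of_nonneg_left h1 (Real.exp_pos (ρ * t)).le
    simp only [Pi.zero_apply]
    linarith
  rw [hint] at hle
  simp only [mul_zero, Real.exp_zero, one_mul] at hle
  have h3 : Real.exp (-ρ * T) * Real.exp (ρ * T) = 1 := by
    rw [← Real.exp_add]; simp
  have h4 := mul_le_mul_of_nonneg_left (sub_nonpos.1 hle) (Real.exp_pos (-ρ * T)).le
  rwa [← mul_assoc, h3, one_mul] at h4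

lemma integral_congr_of_eqOn_uIoc {E : Type*} [NormedAddCommGroup E] [NormedSpace ℝ E]
    {f g : ℝ → E} {a b : ℝ} (h : EqOn f g (uIoc a b)) :
    ∫ s in a..b, f s = ∫ s in a..b, g s :=
  intervalIntegral.integral_congr_ae (Eventually.of_forall h)

/-! ### Matrices as operators, and Carathéodory solutions. -/

section Systems

variable {n : ℕ}

/-- The operator on Euclidean space given by a matrix. -/
noncomputable def op : Matrix (Fin n) (Fin n) ℝ →ₗ[ℝ]
    (EuclideanSpace ℝ (Fin n) →L[ℝ] EuclideanSpace ℝ (Fin n)) :=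
  (Matrix.toEuclideanCLM (n := Fin n) (𝕜 := ℝ)).toAlgEquiv.toLinearMap

lemma op_apply (A : Matrix (Fin n) (Fin n) ℝ) (x : EuclideanSpace ℝ (Fin n)) :
    A.toEuclideanLin x = op A x := rfl

lemma op_injective : Function.Injective (op (n := n)) :=
  (Matrix.toEuclideanCLM (n := Fin n) (𝕜 := ℝ)).injective

lemma continuous_op : Continuous (op (n := n)) :=
  op.continuous_of_finiteDimensional

lemma exists_norm_op_le {𝒜 : Set (Matrix (Fin n) (Fin n) ℝ)} (h𝒜 : IsCompact 𝒜) :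
    ∃ m : ℝ, 0 < m ∧ ∀ B ∈ convexHull ℝ 𝒜, ‖op B‖ ≤ m := by
  obtain ⟨m, hm⟩ := h𝒜.exists_bound_of_continuousOn continuous_op.continuousOn
  refine ⟨max m 1, lt_max_of_lt_right one_pos, fun B hB => ?_⟩
  have hconv : Convex ℝ {B : Matrix (Fin n) (Fin n) ℝ | ‖op B‖ ≤ max m 1} := by
    have := (convex_closedBall (0 : EuclideanSpace ℝ (Fin n) →L[ℝ] EuclideanSpace ℝ (Fin n))
      (max m 1)).linear_preimage (op (n := n))
    simpa [Set.preimage, Metric.closedBall] using this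
  exact convexHull_min (fun A hA => (hm A hA).trans (le_max_left _ _)) hconv hB

lemma dissipates_of_mem_convexHull {𝒜 : Set (Matrix (Fin n) (Fin n) ℝ)}
    {V : Seminorm ℝ (EuclideanSpace ℝ (Fin n))} {ρ : ℝ} (h : ∀ A ∈ 𝒜, Dissipates V ρ (op A))
    {B : Matrix (Fin n) (Fin n) ℝ} (hB : B ∈ convexHull ℝ 𝒜) : Dissipates V ρ (op B) :=
  convexHull_min (t := {B | Dissipates V ρ (op B)}) h
    ((convex_setOf_dissipates V ρ).linear_preimage op) hB

section Solutions

variable {A : ℝ → Matrix (Fin n) (Fin n) ℝ} {x₀ : EuclideanSpace ℝ (Fin n)}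
  {x : ℝ → EuclideanSpace ℝ (Fin n)}

lemma IsCaratheodorySolution.apply_zero (h : IsCaratheodorySolution A x₀ x) : x 0 = x₀ := by
  simpa using h.integral_eq 0 le_rfl

lemma IsCaratheodorySolution.const_smul (h : IsCaratheodorySolution A x₀ x) (k : ℝ) :
    IsCaratheodorySolution A (k • x₀) (fun t => k • x t) where
  integrable t ht := by simpa only [map_smul] using! (h.integrable t ht).smul k
  integral_eq t ht := by
    simp only [map_smul, intervalIntegral.integral_smul, ← smul_add, ← h.integral_eq t ht]

lemma IsCaratheodorySolution.continuousOn (h : IsCaratheodorySolution A x₀ x) {T : ℝ}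
    (hT : 0 ≤ T) : ContinuousOn x (Icc 0 T) := by
  have hc := intervalIntegral.continuousOn_primitive_interval' (h.integrable T hT)
    (left_mem_uIcc)
  rw [uIcc_of_le hT] at hc
  exact (continuousOn_const.add hc).congr fun t ht => h.integral_eq t ht.1

lemma IsCaratheodorySolution.sub_eq_integral (h : IsCaratheodorySolution A x₀ x) {s t : ℝ}
    (hs : 0 ≤ s) (ht : 0 ≤ t) :
    x t - x s = ∫ u in s..t, (A u).toEuclideanLin (x u) := by
  rw [h.integral_eq t ht, h.integral_eq s hs, add_sub_add_left_eq_sub,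
    intervalIntegral.integral_interval_sub_left (h.integrable t ht) (h.integrable s hs)]

lemma IsCaratheodorySolution.exists_lipschitzOnWith (h : IsCaratheodorySolution A x₀ x)
    {𝒜 : Set (Matrix (Fin n) (Fin n) ℝ)} (h𝒜 : IsCompact 𝒜) (hA : IsSwitchingFunction 𝒜 A)
    {T : ℝ} (hT : 0 ≤ T) : ∃ K, LipschitzOnWith K x (Icc 0 T) := by
  obtain ⟨m, hm0, hm⟩ := exists_norm_op_le h𝒜
  obtain ⟨b, hb⟩ := isCompact_Icc.exists_bound_of_continuousOn (h.continuousOn hT)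
  refine ⟨Real.toNNReal (m * b), LipschitzOnWith.of_dist_le_mul fun t ht s hs => ?_⟩
  rw [dist_eq_norm, h.sub_eq_integral hs.1 ht.1, Real.dist_eq]
  refine (intervalIntegral.norm_integral_le_of_norm_le_const (C := m * b) fun u hu => ?_).trans
    (mul_le_mul_of_nonneg_right (Real.le_coe_toNNReal _) (abs_nonneg _))
  have hu' : u ∈ Icc 0 T := by
    have := (uIoc_subset_uIcc.trans (uIcc_subset_Icc hs ht)) hu
    exact this
  rw [op_apply]
  exact ((op (A u)).le_opNorm _).trans (mul_le_mul
    (hm _ (subset_convexHull ℝ _ (hA.mem u hu'.1))) (hb u hu') (norm_nonneg _) hm0.le)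

lemma IsCaratheodorySolution.ae_hasDerivAt (h : IsCaratheodorySolution A x₀ x) {T : ℝ}
    (hT : 0 ≤ T) : ∀ᵐ t, t ∈ uIcc 0 T → HasDerivAt x (op (A t) (x t)) t := by
  -- The integral equation holds only for nonnegative times, so a two-sided derivative at 0 is not
  -- available.
  have h0 : ∀ᵐ t : ℝ, t ≠ 0 := by simp [ae_iff]
  filter_upwards [(h.integrable T hT).ae_hasDerivAt_integral, h0] with t ht ht0 htm
  have hpos : 0 < t := lt_of_le_of_ne (by rw [uIcc_of_le hT] at htm; exact htm.1) ht0.symm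
  refine ((ht htm 0 left_mem_uIcc).const_add x₀).congr_of_eventuallyEq ?_
  filter_upwards [Ioi_mem_nhds hpos] with s hs using h.integral_eq s (le_of_lt hs)

lemma IsCaratheodorySolution.seminorm_le (h : IsCaratheodorySolution A x₀ x)
    {𝒜 : Set (Matrix (Fin n) (Fin n) ℝ)} (h𝒜 : IsCompact 𝒜) (hA : IsSwitchingFunction 𝒜 A)
    {V : Seminorm ℝ (EuclideanSpace ℝ (Fin n))} {C ρ : ℝ} (hVC : ∀ y, V y ≤ C * ‖y‖)
    (hV : ∀ B ∈ 𝒜, Dissipates V ρ (op B)) {t : ℝ} (ht : 0 ≤ t) :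
    V (x t) ≤ Real.exp (-ρ * t) * V x₀ := by
  obtain ⟨K, hK⟩ := h.exists_lipschitzOnWith h𝒜 hA ht
  have hVL : LipschitzWith (Real.toNNReal C) V := LipschitzWith.of_dist_le_mul fun y z => by
    rw [Real.dist_eq, dist_eq_norm]
    exact (abs_sub_map_le_sub V y z).trans ((hVC _).trans
      (mul_le_mul_of_nonneg_right (Real.le_coe_toNNReal C) (norm_nonneg _)))
  have hac : AbsolutelyContinuousOnInterval (fun s => V (x s)) 0 t := by
    refine LipschitzOnWith.absolutelyContinuousOnInterval (K := Real.toNNReal C * K) ?_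
    rw [uIcc_of_le ht]
    exact hVL.comp_lipschitzOnWith hK
  rw [← h.apply_zero]
  refine le_exp_mul_of_ae_deriv_le ht hac ?_
  filter_upwards [hac.ae_differentiableAt, h.ae_hasDerivAt ht] with s hs hs' hsm
  obtain ⟨f, hf, hfs⟩ := exists_support_functional V (x s)
  rw [deriv_seminorm_comp_eq (hs' hsm) (hs hsm) hf hfs]
  rw [uIcc_of_le ht] at hsm
  exact hV _ (hA.mem s hsm.1) f hf _ hfs

/-- A solution can be continued after time `T` with a constant matrix. -/
lemma IsCaratheodorySolution.append (h : IsCaratheodorySolution A x₀ x) {T : ℝ} (hT : 0 ≤ T)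
    (B : Matrix (Fin n) (Fin n) ℝ) :
    IsCaratheodorySolution (fun s => if s ≤ T then A s else B) x₀
      (fun s => if s ≤ T then x s else NormedSpace.exp ((s - T) • op B) (x T)) := by
  set φ : ℝ → EuclideanSpace ℝ (Fin n) := fun s =>
    (if s ≤ T then A s else B).toEuclideanLin
      (if s ≤ T then x s else NormedSpace.exp ((s - T) • op B) (x T)) with hφ
  have hleft : ∀ t, 0 ≤ t → t ≤ T → EqOn (fun s => (A s).toEuclideanLin (x s)) φ (uIoc 0 t) := by
    intro t ht0 htT s hs
    rw [uIoc_of_le ht0] at hs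
    simp [hφ, hs.2.trans htT]
  have hright : ∀ t, T ≤ t →
      EqOn (fun s => op B (NormedSpace.exp ((s - T) • op B) (x T))) φ (uIoc T t) := by
    intro t htT s hs
    rw [uIoc_of_le htT] at hs
    simp [hφ, not_le.2 hs.1, op_apply]
  have hder := hasDerivAt_exp_smul_apply (op B) (x T) T
  have hcont : Continuous fun s => op B (NormedSpace.exp ((s - T) • op B) (x T)) :=
    (op B).continuous.comp (continuous_iff_continuousAt.2 fun s => (hder s).continuousAt)
  have hil : ∀ t, 0 ≤ t → t ≤ T → IntervalIntegrable φ volume 0 t := fun t ht0 htT =>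
    (h.integrable t ht0).congr (hleft t ht0 htT)
  have hir : ∀ t, T ≤ t → IntervalIntegrable φ volume T t := fun t htT =>
    (hcont.intervalIntegrable T t).congr (hright t htT)
  have hintl : ∀ t, 0 ≤ t → t ≤ T → x t = x₀ + ∫ s in (0 : ℝ)..t, φ s := fun t ht0 htT => by
    rw [h.integral_eq t ht0, integral_congr_of_eqOn_uIoc (hleft t ht0 htT)]
  refine ⟨fun t ht0 => ?_, fun t ht0 => ?_⟩
  · rcases le_total t T with htT | htT
    · exact hil t ht0 htT
    · exact (hil T hT le_rfl).trans (hir t htT)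
  · rcases le_or_gt t T with htT | htT
    · simpa [htT] using hintl t ht0 htT
    · have h1 := intervalIntegral.integral_eq_sub_of_hasDerivAt (fun s _ => hder s)
        (hcont.intervalIntegrable T t)
      rw [integral_congr_of_eqOn_uIoc (hright t htT.le)] at h1
      simp only [sub_self, zero_smul, NormedSpace.exp_zero, one_apply_eq_self] at h1
      simp only [not_le.2 htT, if_false]
      rw [← intervalIntegral.integral_add_adjacent_intervals (hil T hT le_rfl) (hir t htT.le),
        ← add_assoc, ← hintl T hT le_rfl, h1, add_sub_cancel]

lemma isCaratheodorySolution_exp (B : Matrix (Fin n) (Fin n) ℝ)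
    (x₀ : EuclideanSpace ℝ (Fin n)) :
    IsCaratheodorySolution (fun _ => B) x₀ (fun s => NormedSpace.exp (s • op B) x₀) := by
  have hder : ∀ t, HasDerivAt (fun s : ℝ => NormedSpace.exp (s • op B) x₀)
      (op B (NormedSpace.exp (t • op B) x₀)) t := fun t => by
    simpa using hasDerivAt_exp_smul_apply (op B) x₀ 0 t
  have hcont : Continuous fun s : ℝ => op B (NormedSpace.exp (s • op B) x₀) :=
    (op B).continuous.comp (continuous_iff_continuousAt.2 fun s => (hder s).continuousAt)
  refine ⟨fun t _ => hcont.intervalIntegrable 0 t, fun t _ => ?_⟩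
  have h1 := intervalIntegral.integral_eq_sub_of_hasDerivAt (fun s _ => hder s)
    (hcont.intervalIntegrable 0 t)
  rw [exp_zero_smul_apply] at h1
  exact (add_eq_of_eq_sub' h1).symm

end Solutions

/-! ### From stability to a Lyapunov seminorm. -/

lemma exp_smul_add_smul_one (B : Matrix (Fin n) (Fin n) ℝ) (r t : ℝ)
    (y : EuclideanSpace ℝ (Fin n)) :
    NormedSpace.exp (t • (op B + r • 1)) y
      = Real.exp (r * t) • NormedSpace.exp (t • op B) y := by
  have h1 : t • (op B + r • 1)
      = algebraMap ℝ (EuclideanSpace ℝ (Fin n) →L[ℝ] EuclideanSpace ℝ (Fin n)) (r * t)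
        + t • op B := by
    rw [Algebra.algebraMap_eq_smul_one, smul_add, smul_smul, add_comm, mul_comm]
  have hcomm := Algebra.commutes (r * t) (t • op B)
  let +nondep : NormedAlgebra ℚ (EuclideanSpace ℝ (Fin n) →L[ℝ] EuclideanSpace ℝ (Fin n)) :=
    .restrictScalars ℚ ℝ _
  rw [h1, NormedSpace.exp_add_of_commute hcomm, ← NormedSpace.algebraMap_exp_comm,
    Algebra.algebraMap_eq_smul_one, ← Real.exp_eq_exp_ℝ]
  simp

/-- The monoid generated by the flows of `A + r`, `A ∈ 𝒜`. -/
noncomputable def flowMonoid (𝒜 : Set (Matrix (Fin n) (Fin n) ℝ)) (r : ℝ) :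
    Submonoid (EuclideanSpace ℝ (Fin n) →L[ℝ] EuclideanSpace ℝ (Fin n)) :=
  Submonoid.closure {g | ∃ B ∈ 𝒜, ∃ t : ℝ, 0 ≤ t ∧ g = NormedSpace.exp (t • (op B + r • 1))}

/-- A product of flows is a concatenation of constant switching pieces of total length `T`; the
shift by `r` contributes `exp (r * T)`. -/
lemma exists_solution_of_mem_flowMonoid {𝒜 : Set (Matrix (Fin n) (Fin n) ℝ)}
    (hne : 𝒜.Nonempty) {r : ℝ} {g : EuclideanSpace ℝ (Fin n) →L[ℝ] EuclideanSpace ℝ (Fin n)}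
    (hg : g ∈ flowMonoid 𝒜 r) (x₀ : EuclideanSpace ℝ (Fin n)) :
    ∃ A x T, IsSwitchingFunction 𝒜 A ∧ IsCaratheodorySolution A x₀ x ∧ 0 ≤ T ∧
      g x₀ = Real.exp (r * T) • x T := by
  induction hg using Submonoid.closure_induction_left with
  | one =>
    obtain ⟨B, hB⟩ := hne
    exact ⟨fun _ => B, fun s => NormedSpace.exp (s • op B) x₀, 0, ⟨fun _ _ => measurable_const, fun _ _ => hB⟩,
      isCaratheodorySolution_exp B x₀, le_rfl, by
        rw [mul_zero, Real.exp_zero, one_smul]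
        exact (exp_zero_smul_apply (op B) x₀).symm⟩
  | mul_left k hk g hg ih =>
    obtain ⟨B, hB, t, ht, rfl⟩ := hk
    obtain ⟨A, x, T, hA, hx, hT, hgx⟩ := ih
    refine ⟨_, _, T + t, ⟨fun i j => ?_, fun s hs => ?_⟩, hx.append hT B, by positivity, ?_⟩
    · simp only [apply_ite (fun M : Matrix (Fin n) (Fin n) ℝ => M i j)]
      exact Measurable.ite measurableSet_Iic (hA.measurable i j) measurable_const
    · split_ifs
      exacts [hA.mem s hs, hB]
    · rw [mul_apply_eq_comp, hgx, map_smul, exp_smul_add_smul_one, smul_smul,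
        ← Real.exp_add, ← mul_add]
      -- At `t = 0` the time `T + t` still falls in the branch `s ≤ T`.
      rcases ht.eq_or_lt with rfl | ht
      · simp only [add_zero, le_refl, if_true, exp_zero_smul_apply]
      · simp [not_le.2 ht]

/-- A uniform exponential bound on the solutions yields a Lyapunov seminorm. -/
lemma exists_lyapunov {𝒜 : Set (Matrix (Fin n) (Fin n) ℝ)} (hne : 𝒜.Nonempty) {C r : ℝ}
    (h : ∀ A, IsSwitchingFunction 𝒜 A → ∀ x₀ x, IsCaratheodorySolution A x₀ x →
      ∀ t : ℝ, 0 ≤ t → ‖x t‖ ≤ C * Real.exp (-r * t) * ‖x₀‖) :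
    ∃ V : Seminorm ℝ (EuclideanSpace ℝ (Fin n)), (∀ x, ‖x‖ ≤ V x) ∧ (∀ x, V x ≤ C * ‖x‖) ∧
      ∀ B ∈ 𝒜, Dissipates V r (op B) := by
  obtain ⟨V, h1, h2, h3⟩ := exists_seminorm_contractive (flowMonoid 𝒜 r) (C := C) (by
    intro g hg x₀
    obtain ⟨A, x, T, hA, hx, hT, hgx⟩ := exists_solution_of_mem_flowMonoid hne hg x₀
    have hb := mul_le_mul_of_nonneg_left (h A hA x₀ x hx T hT) (Real.exp_pos (r * T)).le
    have he : Real.exp (r * T) * Real.exp (-r * T) = 1 := by rw [← Real.exp_add]; simp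
    rw [hgx, norm_smul, Real.norm_of_nonneg (Real.exp_pos _).le]
    refine hb.trans_eq ?_
    linear_combination C * ‖x₀‖ * he)
  exact ⟨V, h1, h2, fun B hB => dissipates_of_contractive fun t ht =>
    h3 _ (Submonoid.subset_closure ⟨B, hB, t, ht, rfl⟩)⟩

lemma norm_le_of_uniformlyStable {𝒜 : Set (Matrix (Fin n) (Fin n) ℝ)} (h : UniformlyStable 𝒜) :
    ∃ C : ℝ, ∀ A, IsSwitchingFunction 𝒜 A → ∀ x₀ x, IsCaratheodorySolution A x₀ x →
      ∀ t : ℝ, 0 ≤ t → ‖x t‖ ≤ C * ‖x₀‖ := by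
  obtain ⟨δ, hδ, h⟩ := h 1 one_pos
  refine ⟨δ⁻¹, fun A hA x₀ x hx t ht => ?_⟩
  -- Rescaling by `δ / (‖x₀‖ + η)` instead of `δ / ‖x₀‖` also covers `x₀ = 0`.
  have key : ∀ η : ℝ, 0 < η → δ * ‖x t‖ ≤ ‖x₀‖ + η := by
    intro η hη
    have hpos : 0 < ‖x₀‖ + η := by positivity
    have hk : 0 < δ / (‖x₀‖ + η) := by positivity
    have := h A hA _ _ (hx.const_smul (δ / (‖x₀‖ + η))) (by
      rw [norm_smul, Real.norm_of_nonneg hk.le, div_mul_eq_mul_div, div_le_iff₀ hpos]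
      nlinarith) t ht
    rwa [norm_smul, Real.norm_of_nonneg hk.le, div_mul_eq_mul_div, div_le_iff₀ hpos,
      one_mul] at this
  rw [inv_mul_eq_div, le_div_iff₀ hδ, mul_comm]
  exact le_of_forall_pos_le_add key

/-! ### Transfer of stability through the semicone. -/

lemma not_isSwitchingFunction {𝒜 𝒜' : Set (Matrix (Fin n) (Fin n) ℝ)} (hempty : 𝒜 = ∅)
    (hsub : 𝒜' ⊆ convexSemicone 𝒜) (A : ℝ → Matrix (Fin n) (Fin n) ℝ) :
    ¬ IsSwitchingFunction 𝒜' A := by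
  intro hA
  obtain ⟨c, -, B, hB, -⟩ := hsub (hA.mem 0 le_rfl)
  simp [hempty] at hB

lemma subset_convexSemicone {E : Type*} [AddCommGroup E] [Module ℝ E] (D : Set E) :
    D ⊆ convexSemicone D := fun x hx => ⟨1, one_pos, x, subset_convexHull ℝ D hx, by simp⟩

lemma UniformlyStable.of_subset_convexSemicone {𝒜 𝒜' : Set (Matrix (Fin n) (Fin n) ℝ)}
    (h𝒜' : IsCompact 𝒜') (hsub : 𝒜' ⊆ convexSemicone 𝒜) (h : UniformlyStable 𝒜) :
    UniformlyStable 𝒜' := by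
  intro ε hε
  rcases 𝒜.eq_empty_or_nonempty with hempty | hne
  · exact ⟨1, one_pos, fun A hA => absurd hA (not_isSwitchingFunction hempty hsub A)⟩
  obtain ⟨C, hC⟩ := norm_le_of_uniformlyStable h
  obtain ⟨V, h1, h2, h3⟩ := exists_lyapunov hne (C := C) (r := 0) (by simpa using hC)
  refine ⟨ε / max C 1, by positivity, fun A hA x₀ x hx hx₀ t ht => ?_⟩
  have hd : ∀ B ∈ 𝒜', Dissipates V 0 (op B) := by
    intro B' hB'
    obtain ⟨c, hc, B, hB, rfl⟩ := hsub hB'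
    simpa using (dissipates_of_mem_convexHull h3 hB).smul hc.le
  have hV := hx.seminorm_le h𝒜' hA h2 hd ht
  simp only [neg_zero, zero_mul, Real.exp_zero, one_mul] at hV
  calc ‖x t‖ ≤ C * ‖x₀‖ := (h1 _).trans (hV.trans (h2 _))
    _ ≤ max C 1 * (ε / max C 1) := by gcongr; exact le_max_left _ _
    _ = ε := by field_simp

lemma exists_pos_le_norm_op {𝒜 : Set (Matrix (Fin n) (Fin n) ℝ)} (h𝒜 : IsCompact 𝒜)
    (h0 : (0 : Matrix (Fin n) (Fin n) ℝ) ∉ 𝒜) : ∃ m : ℝ, 0 < m ∧ ∀ B ∈ 𝒜, m ≤ ‖op B‖ := by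
  rcases 𝒜.eq_empty_or_nonempty with rfl | hne
  · exact ⟨1, one_pos, by simp⟩
  obtain ⟨B, hB, hmin⟩ := h𝒜.exists_isMinOn hne (f := fun B => ‖op B‖)
    continuous_op.norm.continuousOn
  refine ⟨‖op B‖, norm_pos_iff.2 fun h => h0 ?_, fun B' hB' => hmin hB'⟩
  rwa [← (map_eq_zero_iff op op_injective).1 h]

lemma GUES.of_subset_convexSemicone {𝒜 𝒜' : Set (Matrix (Fin n) (Fin n) ℝ)}
    (h𝒜 : IsCompact 𝒜) (h𝒜' : IsCompact 𝒜') (hsub : 𝒜' ⊆ convexSemicone 𝒜) (h : GUES 𝒜) :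
    GUES 𝒜' := by
  rcases 𝒜.eq_empty_or_nonempty with hempty | hne
  · exact ⟨1, 1, one_pos, one_pos,
      fun A hA => absurd hA (not_isSwitchingFunction hempty hsub A)⟩
  obtain ⟨M, r, hM, hr, h⟩ := h
  -- The GUES bound is given for `t > 0` only; at `t = 0` the constant must be at least 1.
  obtain ⟨V, h1, h2, h3⟩ := exists_lyapunov hne (C := max M 1) (r := r) (by
    intro A hA x₀ x hx t ht
    rcases ht.eq_or_lt with rfl | ht
    · rw [hx.apply_zero, mul_zero, Real.exp_zero, mul_one]
      exact le_mul_of_one_le_left (norm_nonneg _) (le_max_right _ _)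
    · refine (h A hA x₀ x hx t ht).trans ?_
      gcongr
      exact le_max_left _ _)
  by_cases h0 : (0 : Matrix (Fin n) (Fin n) ℝ) ∈ 𝒜'
  -- Here 0 lies in the hull of `𝒜`, so `0 ≤ -r * V y`, which forces `V = 0`.
  · obtain ⟨c, hc, B, hB, hcB⟩ := hsub h0
    obtain rfl : B = 0 := (smul_eq_zero.1 hcB.symm).resolve_left hc.ne'
    have hzero : ∀ y : EuclideanSpace ℝ (Fin n), ‖y‖ ≤ 0 := by
      intro y
      obtain ⟨f, hf, hfy⟩ := exists_support_functional V y
      have := dissipates_of_mem_convexHull h3 hB f hf y hfy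
      simp only [map_zero, zero_apply] at this
      nlinarith [h1 y]
    exact ⟨1, 1, one_pos, one_pos, fun A hA x₀ x hx t ht => (hzero _).trans (by positivity)⟩
  · obtain ⟨m, hm, hmle⟩ := exists_norm_op_le h𝒜
    obtain ⟨m', hm', hle⟩ := exists_pos_le_norm_op h𝒜' h0
    -- If `c • B ∈ 𝒜'` with `B` in the hull of `𝒜`, then `m' ≤ c * ‖op B‖ ≤ c * m`, so `c ≥ m' / m`.
    refine ⟨max M 1, m' / m * r, by positivity, by positivity,
      fun A hA x₀ x hx t ht => ?_⟩
    have hd : ∀ B ∈ 𝒜', Dissipates V (m' / m * r) (op B) := by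
      intro B' hB'
      obtain ⟨c, hc, B, hB, rfl⟩ := hsub hB'
      have hcB : m' ≤ c * m := by
        refine (hle _ hB').trans ?_
        rw [map_smul, norm_smul, Real.norm_of_nonneg hc.le]
        exact mul_le_mul_of_nonneg_left (hmle B hB) hc.le
      rw [map_smul]
      exact ((dissipates_of_mem_convexHull h3 hB).smul hc.le).mono
        (mul_le_mul_of_nonneg_right ((div_le_iff₀ hm).2 hcB) hr.le)
    have hV := hx.seminorm_le h𝒜' hA h2 hd ht.le
    calc ‖x t‖ ≤ Real.exp (-(m' / m * r) * t) * (max M 1 * ‖x₀‖) :=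
          (h1 _).trans (hV.trans (mul_le_mul_of_nonneg_left (h2 _) (Real.exp_pos _).le))
      _ = max M 1 * Real.exp (-(m' / m * r) * t) * ‖x₀‖ := by ring

end Systems

end SwitchedSystem

theorem proposition1 (n : ℕ) (𝒜 𝒜' : Set (Matrix (Fin n) (Fin n) ℝ))
    (h𝒜 : IsCompact 𝒜) (h𝒜' : IsCompact 𝒜')
    (hcone : SwitchedSystem.convexSemicone 𝒜 = SwitchedSystem.convexSemicone 𝒜') :
    (SwitchedSystem.GUES 𝒜 ↔ SwitchedSystem.GUES 𝒜') ∧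
      (SwitchedSystem.UniformlyStable 𝒜 ↔ SwitchedSystem.UniformlyStable 𝒜') := by
  have h1 : 𝒜' ⊆ SwitchedSystem.convexSemicone 𝒜 :=
    hcone ▸ SwitchedSystem.subset_convexSemicone 𝒜'
  have h2 : 𝒜 ⊆ SwitchedSystem.convexSemicone 𝒜' :=
    hcone ▸ SwitchedSystem.subset_convexSemicone 𝒜
  exact ⟨⟨.of_subset_convexSemicone h𝒜 h𝒜' h1, .of_subset_convexSemicone h𝒜' h𝒜 h2⟩,
    ⟨.of_subset_convexSemicone h𝒜' h1, .of_subset_convexSemicone h𝒜 h2⟩⟩
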